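/- For a sequence of positive integers $k_1,\dots,k_r$ and signs $\sigma_1,\dots,\sigma_r\in\{\pm1\}$ with $(k_1,\sigma_1)\ne(1,1)$, the alternating multiple $T$-value is $$T^{\sigma_1,\dots,\sigma_r}(k_1,\dots,k_r):=\lim_{n\to\infty}T_n^{\sigma_1,\dots,\sigma_r}(k_1,\dots,k_r),\qquad T_n^{\sigma_1,\dots,\sigma_r}(k_1,\dots,k_r):=\sum 2^r\prod_{j=1}^r\frac{\sigma_j^{n_j}}{d_j^{\,k_j}},$$ where $d_j=2n_j-1$ if $r-j$ is even and $d_j=2n_j$ if $r-j$ is odd, and the sum runs over all tuples of positive integers $n_1,\dots,n_r$ with $2n>d_1>d_2>\cdots>d_r>0$. A bar over $k_j$ indicates that $\sigma_j=-1$; entries without a bar have $\sigma_j=1$; and $\{1\}_m$ denotes $m$ consecutive entries $1$. Let $\beta(k)=\sum_{n\ge1}(-1)^{n-1}/(2n-1)^k$ be the Dirichlet beta function. Theorem. For all integers $a,b\ge0$, the limit defining $T(\bar1,\{1\}_a,2,\{1\}_b)$ exists, and $$T(\bar1,\{1\}_a,2,\{1\}_b)\in\mathbb{Q}[\pi,\zeta(2),\beta(2),\zeta(3),\beta(3),\zeta(4),\beta(4),\dots],$$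 the $\mathbb{Q}$-subalgebra of $\mathbb{R}$ generated by $\pi$ and all $\zeta(k)$, $\beta(k)$ with $k\ge2$. -/

import Mathlib

open Filter Topology

/-- In a multiple `T`-harmonic sum of depth `r`, the slot `j` (slots are numbered `0, …, r - 1`)
runs over odd denominators `2 n_j - 1` exactly when its distance to the last slot is even. -/
abbrev IsOddSlot (r j : ℕ) : Prop := Even (r - 1 - j)

/-- The summation range of the multiple `T`-harmonic sums of depth `r`: all tuples of positive
integers with `n ≥ n_1 > n_2 ≥ n_3 > ⋯ > n_{r-1} ≥ n_r > 0` if `r` is odd and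
`n > n_1 ≥ n_2 > n_3 ≥ ⋯ > n_{r-1} ≥ n_r > 0` if `r` is even. In both cases an inequality is
non-strict exactly if its smaller side is an odd slot. -/
def tRange (n r : ℕ) : Finset (Fin r → ℕ) :=
  (Fintype.piFinset fun _ : Fin r => Finset.Icc 1 n).filter fun v =>
    (∀ j : Fin r, j.val = 0 → if IsOddSlot r j.val then v j ≤ n else v j < n) ∧
    ∀ i j : Fin r, i.val + 1 = j.val →
      if IsOddSlot r j.val then v j ≤ v i else v j < v i

/-- The denominator base at slot `j`: `2 m - 1` in an odd slot and `2 m` in an even one. -/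
noncomputable def tBase (r j m : ℕ) : ℝ :=
  if IsOddSlot r j then 2 * (m : ℝ) - 1 else 2 * (m : ℝ)

/-- The alternating multiple `T`-harmonic sum `T_n^{σ_1, …, σ_r}(k_1, …, k_r)`, where `s` is the
list of the pairs `(σ_j, k_j)` with a sign `σ_j = ±1` and a positive integer `k_j`:
the sum over the range above of `2 ^ r ∏_j σ_j ^ n_j / (base at slot j) ^ k_j`. -/
noncomputable def altTHarmonic (n : ℕ) (s : List (ℤ × ℕ)) : ℝ :=
  ∑ v ∈ tRange n s.length,
    2 ^ s.length * ∏ j : Fin s.length,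
      (((s.get j).1 : ℝ) ^ v j) / (tBase s.length j.val (v j)) ^ (s.get j).2

/-- The alternating multiple `T`-value: the limit of the harmonic sums as `n → ∞`
(meaningful only when that limit exists). -/
noncomputable def altT (s : List (ℤ × ℕ)) : ℝ :=
  limUnder atTop fun n : ℕ => altTHarmonic n s

/-- The decorated composition `(1̄, {1}_a, 2, {1}_b)`; only the first entry carries the sign `-1`. -/
def barOneTwo (a b : ℕ) : List (ℤ × ℕ) :=
  (-1, 1) :: (List.replicate a (1, 1) ++ (1, 2) :: List.replicate b (1, 1))

/-- The Dirichlet beta value `β(k) = ∑_{n ≥ 1} (-1)^(n-1) / (2 n - 1)^k`, used for `k ≥ 2` only,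
where the series converges absolutely. -/
noncomputable def betaValue (k : ℕ) : ℝ :=
  ∑' n : ℕ, (-1 : ℝ) ^ n / (2 * (n : ℝ) + 1) ^ k

/-- The subring `ℚ[π, ζ(2), β(2), ζ(3), β(3), ζ(4), …]` of `ℝ`. -/
noncomputable def piZetaBetaRing : Subalgebra ℚ ℝ :=
  Algebra.adjoin ℚ
    ({Real.pi} ∪ {x : ℝ | ∃ k : ℕ, 2 ≤ k ∧ (x : ℂ) = riemannZeta (k : ℂ)} ∪
      {x : ℝ | ∃ k : ℕ, 2 ≤ k ∧ x = betaValue k})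

/-! Indexed by the largest denominator `d`, the value is, up to a unit, the power series `tSeries`
with coefficients `tCoeff` evaluated at `z = i`, since the sign `(-1) ^ ⌈d/2⌉` is a unit times `i ^
d`. A leading exponent 1 means integrating against `2 dz / (1 - z²)`, and lowering an exponent 2 to
1 means integrating against `dz / z`. Under `z = i tan(φ/2)` these forms become `i dφ` and `dφ / sin
φ` (`hasDerivAt_tTrig_one`, `hasDerivAt_tTrig_succ`). Hence `{1}_m` gives `(iφ)^m / m!`, and
Cauchy's repeated integration formula yields, up to sign, `1 / ((a+1)! (b+1)!) ∫_0^{π/2} (π/2 -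
t)^(a+1) t^(b+1) / sin t dt`. The endpoint `φ = π/2` is `z = i`, on the circle of convergence:
summation by parts gives convergence there, and Abel's theorem identifies the sum.

To evaluate the integral, expand `(π/2 - t)^(a+1)` and use `1 / sin t = 2 ∑ sin((2k+1)t)`, justified
by a closed form for the partial sums and the Riemann–Lebesgue lemma. Integrating the moments by
parts leaves powers of `π/2` times sums of `1 / (2k+1)^p` or `(-1)^k / (2k+1)^p` with `p ≥ 2`, that
is, rational multiples of `ζ(p)` or `β(p)`. -/

/-! ### Recursion of the harmonic sums in the first index -/

theorem isOddSlot_zero (r : ℕ) : IsOddSlot (r + 1) 0 ↔ Even r := by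
  simp [IsOddSlot]

theorem isOddSlot_succ (r j : ℕ) : IsOddSlot (r + 1) (j + 1) ↔ IsOddSlot r j := by
  simp only [IsOddSlot]
  rw [show r + 1 - 1 - (j + 1) = r - 1 - j by omega]

theorem tBase_succ (r j m : ℕ) : tBase (r + 1) (j + 1) m = tBase r j m := by
  simp only [tBase, isOddSlot_succ]

/-- The values that the first entry of a tuple in `tRange n (r + 1)` may take. -/
def firstRange (n r : ℕ) : Finset ℕ :=
  (Finset.Icc 1 n).filter fun m => if Even r then m ≤ n else m < n

theorem le_head_of_mem_tRange {n r : ℕ} {v : Fin (r + 1) → ℕ} (h : v ∈ tRange n (r + 1))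
    (j : Fin (r + 1)) : v j ≤ v 0 := by
  obtain ⟨_, _, h2⟩ := by simpa [tRange] using h
  induction j using Fin.induction with
  | zero => rfl
  | succ i ih =>
    have := h2 i.castSucc i.succ (by simp)
    split_ifs at this <;> omega

/-- Slot parity is counted from the last slot, so it survives deleting the first one; the inequality
between the first two entries then becomes the outer bound, with `m` in place of `n`. -/
theorem cons_mem_tRange {n r m : ℕ} {w : Fin r → ℕ} :
    (Fin.cons m w : Fin (r + 1) → ℕ) ∈ tRange n (r + 1) ↔ m ∈ firstRange n r ∧ w ∈ tRange m r := by
  constructor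
  · intro h
    have hle := le_head_of_mem_tRange h
    simp only [tRange, Finset.mem_filter, Fintype.mem_piFinset, Finset.mem_Icc] at h
    obtain ⟨h0, h1, h2⟩ := h
    have e0 := h0 0
    have e1 := h1 0 rfl
    simp only [Fin.cons_zero, Fin.val_zero, isOddSlot_zero] at e0 e1
    refine ⟨by simp only [firstRange, Finset.mem_filter, Finset.mem_Icc]; exact ⟨e0, e1⟩, ?_⟩
    simp only [tRange, Finset.mem_filter, Fintype.mem_piFinset, Finset.mem_Icc]
    refine ⟨fun i => ⟨by simpa using (h0 i.succ).1, by simpa using hle i.succ⟩, ?_, ?_⟩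
    · intro j hj
      have := h2 0 j.succ (by simp [hj])
      simpa [isOddSlot_succ] using this
    · intro i j hij
      have := h2 i.succ j.succ (by simp [hij])
      simpa [isOddSlot_succ] using this
  · rintro ⟨hm, hw⟩
    simp only [firstRange, Finset.mem_filter, Finset.mem_Icc] at hm
    simp only [tRange, Finset.mem_filter, Fintype.mem_piFinset, Finset.mem_Icc] at hw ⊢
    obtain ⟨h0, h1, h2⟩ := hw
    refine ⟨?_, ?_, ?_⟩
    · intro i
      refine Fin.cases ?_ (fun i => ?_) i
      · simpa using hm.1
      · have := h0 i
        simp only [Fin.cons_succ]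
        omega
    · intro j
      refine Fin.cases ?_ (fun i => ?_) j
      · intro _
        simpa [isOddSlot_zero] using hm.2
      · simp
    · intro i j
      refine Fin.cases ?_ (fun j => ?_) j
      · simp
      · refine Fin.cases ?_ (fun i => ?_) i
        · intro h
          have := h1 j (by simpa using h.symm)
          simpa [isOddSlot_succ] using this
        · intro h
          have := h2 i j (by simpa using h)
          simpa [isOddSlot_succ] using this

theorem altTHarmonic_nil (n : ℕ) : altTHarmonic n [] = 1 := by
  simp [altTHarmonic, tRange]

theorem altTHarmonic_cons (n : ℕ) (p : ℤ × ℕ) (s : List (ℤ × ℕ)) :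
    altTHarmonic n (p :: s) = ∑ m ∈ firstRange n s.length,
      2 * (p.1 : ℝ) ^ m / tBase (s.length + 1) 0 m ^ p.2 * altTHarmonic m s := by
  simp only [altTHarmonic, Finset.mul_sum]
  rw [Finset.sum_sigma']
  symm
  refine Finset.sum_bij (fun x _ => (Fin.cons x.1 x.2 : Fin (s.length + 1) → ℕ)) ?_ ?_ ?_ ?_
  · rintro ⟨m, w⟩ h
    exact cons_mem_tRange.2 (by simpa using h)
  · rintro ⟨m, w⟩ _ ⟨m', w'⟩ _ h
    obtain ⟨h1, h2⟩ := Fin.cons_inj.1 h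
    subst h1 h2
    rfl
  · intro v hv
    refine ⟨⟨v 0, Fin.tail v⟩, ?_, Fin.cons_self_tail v⟩
    rw [Finset.mem_sigma]
    exact cons_mem_tRange.1 ((Fin.cons_self_tail v).symm ▸ hv)
  · rintro ⟨m, w⟩ _
    simp only [List.length_cons, Fin.prod_univ_succ, Fin.cons_zero, Fin.cons_succ, Fin.val_succ,
      tBase_succ, Fin.val_zero]
    change _ = 2 ^ (s.length + 1) * ((p.1 : ℝ) ^ m / tBase (s.length + 1) 0 m ^ p.2 *
      ∏ x : Fin s.length, ((s.get x).1 : ℝ) ^ w x / tBase s.length x.val (w x) ^ (s.get x).2)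
    ring

/-! ### Reindexing by the largest denominator -/

/-- The contribution of the tuples with largest denominator `d` to the multiple `T`-value without
signs whose exponents are listed in `s`. -/
noncomputable def tCoeff : List ℕ → ℕ → ℝ
  | [], d => if d = 0 then 1 else 0
  | k :: s, d =>
    if d % 2 = (s.length + 1) % 2 then 2 / (d : ℝ) ^ k * ∑ e ∈ Finset.range d, tCoeff s e else 0

theorem tCoeff_eq_zero_of_parity {s : List ℕ} {d : ℕ} (h : d % 2 ≠ s.length % 2) :
    tCoeff s d = 0 := by
  cases s with
  | nil =>
    have : d ≠ 0 := by rintro rfl; simp at h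
    simp [tCoeff, this]
  | cons k s => simp [tCoeff] at h ⊢; intro h'; exact absurd h' h

theorem tCoeff_cons_zero (k : ℕ) (s : List ℕ) : tCoeff (k :: s) 0 = 0 := by
  simp [tCoeff]

/-- Here `d = 2m - 1` or `d = 2m`, and `(d + 1) / 2` recovers `m` in both cases. For odd `r` the
right side also contains `d = 0`, which `hg` removes. -/
theorem sum_firstRange (r n : ℕ) (g : ℕ → ℝ) (hg : g 0 = 0) :
    ∑ m ∈ firstRange n r, g m =
      ∑ d ∈ Finset.range (2 * n), if d % 2 = (r + 1) % 2 then g ((d + 1) / 2) else 0 := by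
  rcases Nat.even_or_odd r with hr | hr
  · have h1 : (r + 1) % 2 = 1 := by obtain ⟨k, rfl⟩ := hr; omega
    have : firstRange n r = Finset.Ico 1 (n + 1) := by
      ext m; simp only [firstRange, hr, if_true, Finset.mem_filter, Finset.mem_Icc, Finset.mem_Ico]
      omega
    rw [this, h1]
    induction n with
    | zero => simp
    | succ n ih =>
      rw [Finset.sum_Ico_succ_top (by omega), ih (by
        ext m; simp only [firstRange, hr, if_true, Finset.mem_filter, Finset.mem_Icc,
          Finset.mem_Ico]; omega), show 2 * (n + 1) = 2 * n + 1 + 1 by ring,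
        Finset.sum_range_succ, Finset.sum_range_succ, if_neg (by omega), if_pos (by omega),
        show (2 * n + 1 + 1) / 2 = n + 1 by omega, add_zero]
  · have h1 : (r + 1) % 2 = 0 := by rw [Nat.odd_iff] at hr; omega
    have : firstRange n r = Finset.Ico 1 n := by
      ext m
      simp only [firstRange, Nat.not_even_iff_odd.2 hr, if_false, Finset.mem_filter,
        Finset.mem_Icc, Finset.mem_Ico]
      omega
    rw [this, h1]
    have h2 : ∑ m ∈ Finset.Ico 1 n, g m = ∑ m ∈ Finset.range n, g m := by
      cases n with
      | zero => simp
      | succ n => rw [Finset.range_eq_Ico, Finset.sum_eq_sum_Ico_succ_bot (Nat.succ_pos n) g, hg, zero_add]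
    rw [h2]
    clear this h2
    induction n with
    | zero => simp
    | succ n ih =>
      rw [Finset.sum_range_succ, ih, show 2 * (n + 1) = 2 * n + 1 + 1 by ring,
        Finset.sum_range_succ, Finset.sum_range_succ, if_pos (by omega), if_neg (by omega),
        show (2 * n + 1) / 2 = n by omega, add_zero]

theorem tBase_half {r d : ℕ} (h : d % 2 = (r + 1) % 2) : tBase (r + 1) 0 ((d + 1) / 2) = d := by
  rw [tBase]
  simp only [isOddSlot_zero]
  rcases Nat.even_or_odd r with hr | hr
  · rw [if_pos hr]
    obtain ⟨k, hk⟩ : ∃ k, d = 2 * k + 1 := ⟨d / 2, by rw [Nat.even_iff] at hr; omega⟩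
    subst hk
    rw [show (2 * k + 1 + 1) / 2 = k + 1 by omega]
    push_cast
    ring
  · rw [if_neg (Nat.not_even_iff_odd.2 hr)]
    obtain ⟨k, hk⟩ : ∃ k, d = 2 * k := ⟨d / 2, by rw [Nat.odd_iff] at hr; omega⟩
    subst hk
    rw [show (2 * k + 1) / 2 = k by omega]
    push_cast
    ring

theorem sum_tCoeff_half {s : List ℕ} {d : ℕ} (h : d % 2 = (s.length + 1) % 2) :
    ∑ e ∈ Finset.range (2 * ((d + 1) / 2)), tCoeff s e = ∑ e ∈ Finset.range d, tCoeff s e := by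
  rcases Nat.even_or_odd d with hd | hd
  · rw [Nat.even_iff] at hd
    rw [show 2 * ((d + 1) / 2) = d by omega]
  · rw [Nat.odd_iff] at hd
    rw [show 2 * ((d + 1) / 2) = d + 1 by omega, Finset.sum_range_succ,
      tCoeff_eq_zero_of_parity (by omega), add_zero]

theorem mem_firstRange_pos {n r m : ℕ} (h : m ∈ firstRange n r) : 0 < m := by
  simp only [firstRange, Finset.mem_filter, Finset.mem_Icc] at h
  omega

/-- The hypothesis is limited to `0 < m` because at `m = 0` the empty list has harmonic sum 1, while
the sum on the right is empty. -/
theorem altTHarmonic_cons_eq_sum {s : List ℕ} (t : List (ℤ × ℕ)) (ht : t.length = s.length)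
    (h : ∀ m, 0 < m → altTHarmonic m t = ∑ e ∈ Finset.range (2 * m), tCoeff s e)
    (σ : ℤ) (k n : ℕ) :
    altTHarmonic n ((σ, k) :: t) =
      ∑ d ∈ Finset.range (2 * n), (σ : ℝ) ^ ((d + 1) / 2) * tCoeff (k :: s) d := by
  have h1 : altTHarmonic n ((σ, k) :: t) = ∑ m ∈ firstRange n s.length,
      2 * (σ : ℝ) ^ m / tBase (s.length + 1) 0 m ^ k * ∑ e ∈ Finset.range (2 * m), tCoeff s e := by
    rw [altTHarmonic_cons, ht]
    refine Finset.sum_congr rfl fun m hm => ?_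
    rw [h m (mem_firstRange_pos hm)]
  rw [h1, sum_firstRange _ _ (fun m => 2 * (σ : ℝ) ^ m / tBase (s.length + 1) 0 m ^ k *
    ∑ e ∈ Finset.range (2 * m), tCoeff s e) (by simp)]
  refine Finset.sum_congr rfl fun d _ => ?_
  simp only [tCoeff]
  split_ifs with hd
  · rw [tBase_half hd, sum_tCoeff_half hd]
    ring
  · simp

theorem altTHarmonic_unsigned (s : List ℕ) (m : ℕ) (hm : 0 < m) :
    altTHarmonic m (s.map fun k => ((1 : ℤ), k)) = ∑ e ∈ Finset.range (2 * m), tCoeff s e := by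
  induction s generalizing m with
  | nil => simp [altTHarmonic_nil, tCoeff, hm]
  | cons k s ih =>
    rw [List.map_cons, altTHarmonic_cons_eq_sum _ (by simp) ih]
    simp

/-- The exponents of the tail of `barOneTwo a b`. -/
def onesTwoOnes (a b : ℕ) : List ℕ := List.replicate a 1 ++ 2 :: List.replicate b 1

theorem length_onesTwoOnes (a b : ℕ) : (onesTwoOnes a b).length = a + b + 1 := by
  simp [onesTwoOnes]; omega

theorem altTHarmonic_barOneTwo (a b n : ℕ) :
    altTHarmonic n (barOneTwo a b) =
      ∑ d ∈ Finset.range (2 * n), (-1 : ℝ) ^ ((d + 1) / 2) * tCoeff (1 :: onesTwoOnes a b) d := by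
  have : barOneTwo a b = (-1, 1) :: (onesTwoOnes a b).map fun k => ((1 : ℤ), k) := by
    simp [barOneTwo, onesTwoOnes]
  rw [this, altTHarmonic_cons_eq_sum _ (by simp) (fun m hm => altTHarmonic_unsigned _ m hm)]
  simp

/-- The unit relating `(-1) ^ ⌈d / 2⌉` to `I ^ d` for `d ≡ r` modulo `2`. -/
noncomputable def slotUnit (r : ℕ) : ℂ := if Even r then 1 else Complex.I

theorem neg_one_pow_half {r d : ℕ} (h : d % 2 = r % 2) :
    (-1 : ℂ) ^ ((d + 1) / 2) = slotUnit r * Complex.I ^ d := by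
  rw [slotUnit]
  rcases Nat.even_or_odd r with hr | hr
  · rw [if_pos hr]
    obtain ⟨k, rfl⟩ : ∃ k, d = 2 * k := ⟨d / 2, by rw [Nat.even_iff] at hr; omega⟩
    rw [show (2 * k + 1) / 2 = k by omega, pow_mul, Complex.I_sq, one_mul]
  · rw [if_neg (Nat.not_even_iff_odd.2 hr)]
    obtain ⟨k, rfl⟩ : ∃ k, d = 2 * k + 1 := ⟨d / 2, by rw [Nat.odd_iff] at hr; omega⟩
    rw [show (2 * k + 1 + 1) / 2 = k + 1 by omega, ← pow_succ',
      show 2 * k + 1 + 1 = 2 * (k + 1) by ring, pow_mul, Complex.I_sq]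

theorem ofReal_altTHarmonic_barOneTwo (a b n : ℕ) :
    (altTHarmonic n (barOneTwo a b) : ℂ) = slotUnit (a + b + 2) *
      ∑ d ∈ Finset.range (2 * n), (tCoeff (1 :: onesTwoOnes a b) d : ℂ) * Complex.I ^ d := by
  rw [altTHarmonic_barOneTwo, Finset.mul_sum]
  push_cast
  refine Finset.sum_congr rfl fun d _ => ?_
  by_cases h : d % 2 = (a + b + 2) % 2
  · rw [neg_one_pow_half h]
    ring
  · rw [tCoeff_eq_zero_of_parity (by simpa only [List.length_cons, length_onesTwoOnes] using h)]
    simp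

/-! ### Coefficient bounds and convergence at `i` -/

theorem tCoeff_nonneg (s : List ℕ) (d : ℕ) : 0 ≤ tCoeff s d := by
  induction s generalizing d with
  | nil => rw [tCoeff]; split_ifs <;> norm_num
  | cons k s ih =>
    rw [tCoeff]
    split_ifs
    · exact mul_nonneg (by positivity) (Finset.sum_nonneg fun e _ => ih e)
    · exact le_rfl

/-- Telescoping: `√(N+1) - √N = 1 / (√(N+1) + √N) ≥ 1 / (3√N)`, since `√(N+1) ≤ 2√N`. -/
theorem sum_one_div_sqrt_le (N : ℕ) : ∑ d ∈ Finset.range N, 1 / √(d : ℝ) ≤ 3 * √(N : ℝ) := by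
  induction N with
  | zero => simp
  | succ N ih =>
    rw [Finset.sum_range_succ]
    rcases Nat.eq_zero_or_pos N with rfl | hN
    · simp
    · have hN' : (1 : ℝ) ≤ N := by exact_mod_cast hN
      have h0 : 0 < √(N : ℝ) := Real.sqrt_pos.2 (by linarith)
      have h1 : √((N + 1 : ℕ) : ℝ) ≤ 2 * √(N : ℝ) := by
        rw [Real.sqrt_le_left (by positivity), mul_pow, Real.sq_sqrt (by linarith)]
        push_cast
        linarith
      have h2 : √((N + 1 : ℕ) : ℝ) ^ 2 = √(N : ℝ) ^ 2 + 1 := by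
        rw [Real.sq_sqrt (by positivity), Real.sq_sqrt (by positivity)]
        push_cast
        ring
      have h3 : √(N : ℝ) ≤ √((N + 1 : ℕ) : ℝ) := Real.sqrt_le_sqrt (by push_cast; linarith)
      have : 1 / √(N : ℝ) ≤ 3 * (√((N + 1 : ℕ) : ℝ) - √(N : ℝ)) := by
        rw [div_le_iff₀ h0]
        nlinarith
      linarith

theorem tCoeff_cons_le {s : List ℕ} {C : ℝ}
    (hC : ∀ N : ℕ, ∑ d ∈ Finset.range N, tCoeff s d ≤ C * √(N : ℝ)) {k : ℕ} (hk : 1 ≤ k) (d : ℕ) :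
    tCoeff (k :: s) d ≤ 2 * C * (1 / √(d : ℝ)) := by
  rcases Nat.eq_zero_or_pos d with rfl | hd
  · simp [tCoeff]
  have hd' : (1 : ℝ) ≤ d := by exact_mod_cast hd
  have h0 : 0 < √(d : ℝ) := Real.sqrt_pos.2 (by linarith)
  have hP := hC d
  have hP0 : 0 ≤ ∑ e ∈ Finset.range d, tCoeff s e := Finset.sum_nonneg fun e _ => tCoeff_nonneg s e
  have h1 : 2 * C * (1 / √(d : ℝ)) = 2 / (d : ℝ) * (C * √(d : ℝ)) := by
    have : (d : ℝ) = √(d : ℝ) * √(d : ℝ) := (Real.mul_self_sqrt (by linarith)).symm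
    field_simp
    rw [Real.sq_sqrt (by linarith)]
  rw [tCoeff, h1]
  split_ifs
  · refine mul_le_mul ?_ hP hP0 (by positivity)
    exact div_le_div_of_nonneg_left (by norm_num) (by linarith) (le_self_pow₀ hd' (by omega))
  · exact mul_nonneg (by positivity) (hP0.trans hP)

/-- A crude bound chosen to reproduce itself: partial sums `≤ C√N` give next coefficients `≤ 2C/√d`,
whose partial sums are `≤ 6C√N`. It avoids tracking powers of logarithms. -/
theorem exists_sum_tCoeff_le {s : List ℕ} (hs : ∀ k ∈ s, 1 ≤ k) :
    ∃ C : ℝ, 0 ≤ C ∧ ∀ N : ℕ, ∑ d ∈ Finset.range N, tCoeff s d ≤ C * √(N : ℝ) := by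
  induction s with
  | nil =>
    refine ⟨1, zero_le_one, fun N => ?_⟩
    rcases Nat.eq_zero_or_pos N with rfl | hN
    · simp
    · have hN' : (1 : ℝ) ≤ N := by exact_mod_cast hN
      simp only [tCoeff, Finset.sum_ite_eq', Finset.mem_range, if_pos hN, one_mul]
      exact Real.one_le_sqrt.2 hN'
  | cons k s ih =>
    obtain ⟨C, hC0, hC⟩ := ih fun j hj => hs j (List.mem_cons_of_mem _ hj)
    refine ⟨6 * C, by positivity, fun N => ?_⟩
    calc ∑ d ∈ Finset.range N, tCoeff (k :: s) d
        ≤ ∑ d ∈ Finset.range N, 2 * C * (1 / √(d : ℝ)) :=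
          Finset.sum_le_sum fun d _ => tCoeff_cons_le hC (hs k (by simp)) d
      _ = 2 * C * ∑ d ∈ Finset.range N, 1 / √(d : ℝ) := by rw [Finset.mul_sum]
      _ ≤ 2 * C * (3 * √(N : ℝ)) :=
          mul_le_mul_of_nonneg_left (sum_one_div_sqrt_le N) (by positivity)
      _ = 6 * C * √(N : ℝ) := by ring

theorem exists_tCoeff_le {s : List ℕ} (hs : ∀ k ∈ s, 1 ≤ k) : ∃ B : ℝ, ∀ d, tCoeff s d ≤ B := by
  cases s with
  | nil => exact ⟨1, fun d => by rw [tCoeff]; split_ifs <;> norm_num⟩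
  | cons k s =>
    obtain ⟨C, hC0, hC⟩ := exists_sum_tCoeff_le fun j hj => hs j (List.mem_cons_of_mem _ hj)
    refine ⟨2 * C, fun d => (tCoeff_cons_le hC (hs k (by simp)) d).trans ?_⟩
    rcases Nat.eq_zero_or_pos d with rfl | hd
    · simpa using hC0
    · refine mul_le_of_le_one_right (by positivity) ?_
      have : 1 ≤ √(d : ℝ) := Real.one_le_sqrt.2 (by exact_mod_cast hd)
      rw [div_le_one (by linarith)]
      exact this

/-- Summation by parts with step 2: as `I ^ (d + 2) = -I ^ d`, twice a partial sum is an absolutely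
convergent sum of differences plus boundary terms. Step 2 is needed because the coefficients vanish
on one parity class. -/
theorem exists_tendsto_sum_mul_I_pow {w : ℕ → ℝ} (hw : Tendsto w atTop (𝓝 0))
    (hs : Summable fun d => |w d - w (d + 2)|) :
    ∃ l : ℂ, Tendsto (fun N => ∑ d ∈ Finset.range N, (w d : ℂ) * Complex.I ^ d) atTop (𝓝 l) := by
  have key : ∀ N, ∑ d ∈ Finset.range N, (w d : ℂ) * Complex.I ^ d =
      (∑ d ∈ Finset.range N, ((w d : ℂ) - w (d + 2)) * Complex.I ^ d + w 0 + w 1 * Complex.I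
        - w N * Complex.I ^ N - w (N + 1) * Complex.I ^ (N + 1)) / 2 := by
    intro N
    induction N with
    | zero => simp
    | succ N ih =>
      rw [Finset.sum_range_succ, ih, Finset.sum_range_succ]
      linear_combination ((w (N + 2) : ℂ) * Complex.I ^ N / 2) * Complex.I_sq
  have hz : Tendsto (fun N => (w N : ℂ) * Complex.I ^ N) atTop (𝓝 0) := by
    rw [tendsto_zero_iff_norm_tendsto_zero]
    simpa using (tendsto_zero_iff_norm_tendsto_zero.1 hw)
  have hsum : Summable fun d => ((w d : ℂ) - w (d + 2)) * Complex.I ^ d := by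
    refine Summable.of_norm ?_
    refine hs.congr fun d => ?_
    rw [norm_mul, norm_pow, Complex.norm_I, one_pow, mul_one, ← Complex.ofReal_sub,
      Complex.norm_real, Real.norm_eq_abs]
  have := ((((hsum.hasSum.tendsto_sum_nat.add_const (w 0 : ℂ)).add_const (w 1 * Complex.I)).sub hz).sub
    (hz.comp (tendsto_add_atTop_nat 1))).div_const 2
  exact ⟨_, this.congr fun N => (key N).symm⟩

theorem tendsto_one_div_sqrt_natCast : Tendsto (fun d : ℕ => 1 / √(d : ℝ)) atTop (𝓝 0) := by
  simp only [one_div]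
  exact (Real.tendsto_sqrt_atTop.comp tendsto_natCast_atTop_atTop).inv_tendsto_atTop

theorem tendsto_tCoeff_cons {k : ℕ} {s : List ℕ} (hk : 1 ≤ k) (hs : ∀ j ∈ s, 1 ≤ j) :
    Tendsto (tCoeff (k :: s)) atTop (𝓝 0) := by
  obtain ⟨C, _, hC⟩ := exists_sum_tCoeff_le hs
  refine squeeze_zero (tCoeff_nonneg _) (tCoeff_cons_le hC hk) ?_
  simpa using tendsto_one_div_sqrt_natCast.const_mul (2 * C)

theorem summable_one_div_mul_sqrt : Summable fun d : ℕ => 1 / ((d : ℝ) * √(d : ℝ)) := by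
  refine (Real.summable_one_div_nat_rpow.2 (by norm_num : (1 : ℝ) < 3 / 2)).congr fun d => ?_
  rcases Nat.eq_zero_or_pos d with rfl | hd
  · simp
  · have : (0 : ℝ) < d := by exact_mod_cast hd
    rw [Real.sqrt_eq_rpow, show (3 / 2 : ℝ) = 1 + 1 / 2 by norm_num, Real.rpow_add this,
      Real.rpow_one]

/-- With `P` a partial sum of size `O(√d)` and `α`, `β` the next two terms of size `O(1/√d)`, the
difference is `4P / (d(d+2)) - 2(α+β) / (d+2)`, hence `O(d^(-3/2))`. -/
theorem summable_tCoeff_sub {k : ℕ} {s : List ℕ} (hk : 1 ≤ k) (hs : ∀ j ∈ s, 1 ≤ j) :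
    Summable fun d => |tCoeff (1 :: k :: s) d - tCoeff (1 :: k :: s) (d + 2)| := by
  obtain ⟨C, hC0, hC⟩ := exists_sum_tCoeff_le hs
  obtain ⟨C', hC0', hC'⟩ := exists_sum_tCoeff_le (s := k :: s)
    (List.forall_mem_cons.2 ⟨hk, hs⟩)
  refine Summable.of_nonneg_of_le (fun d => abs_nonneg _) (fun d => ?_)
    -- At `d = 0` the main majorant is `1 / 0 = 0`, so that one term is added separately.
    (summable_one_div_mul_sqrt.mul_left (8 * C + 4 * C') |>.add
      (summable_of_ne_finset_zero (s := {0}) (f := fun d =>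
        if d = 0 then |tCoeff (1 :: k :: s) 0 - tCoeff (1 :: k :: s) 2| else 0)
        fun d hd => if_neg (by simpa using hd)))
  rcases Nat.eq_zero_or_pos d with rfl | hd
  · simp
  rw [if_neg hd.ne', add_zero]
  have hd' : (1 : ℝ) ≤ d := by exact_mod_cast hd
  have h0 : 0 < √(d : ℝ) := Real.sqrt_pos.2 (by linarith)
  rw [tCoeff, tCoeff]
  by_cases hp : d % 2 = ((k :: s).length + 1) % 2
  · rw [if_pos hp, if_pos (by omega), Finset.sum_range_succ, Finset.sum_range_succ]
    set P := ∑ e ∈ Finset.range d, tCoeff (k :: s) e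
    have hP0 : 0 ≤ P := Finset.sum_nonneg fun e _ => tCoeff_nonneg _ e
    have hP : P ≤ C' * √(d : ℝ) := hC' d
    have ha0 := tCoeff_nonneg (k :: s) d
    have hb0 := tCoeff_nonneg (k :: s) (d + 1)
    have ha := tCoeff_cons_le hC hk d
    have hb : tCoeff (k :: s) (d + 1) ≤ 2 * C * (1 / √(d : ℝ)) := by
      refine (tCoeff_cons_le hC hk (d + 1)).trans ?_
      refine mul_le_mul_of_nonneg_left ?_ (by positivity)
      exact one_div_le_one_div_of_le h0 (Real.sqrt_le_sqrt (by push_cast; linarith))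
    generalize tCoeff (k :: s) d = α at *
    generalize tCoeff (k :: s) (d + 1) = β at *
    have e1 : 2 / (d : ℝ) ^ 1 * P - 2 / ((d + 2 : ℕ) : ℝ) ^ 1 * (P + α + β) =
        4 * P / (d * (d + 2)) - 2 * (α + β) / (d + 2) := by
      push_cast
      field_simp
      ring
    have e2 : 4 * P / ((d : ℝ) * (d + 2)) ≤ 4 * C' * (1 / ((d : ℝ) * √(d : ℝ))) := by
      have : 4 * C' * (1 / ((d : ℝ) * √(d : ℝ))) = 4 * (C' * √(d : ℝ)) / (d * d) := by
        field_simp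
        rw [Real.sq_sqrt (by linarith)]
      rw [this]
      gcongr
      linarith
    have e3 : 2 * (α + β) / ((d : ℝ) + 2) ≤ 8 * C * (1 / ((d : ℝ) * √(d : ℝ))) := by
      have : 8 * C * (1 / ((d : ℝ) * √(d : ℝ))) =
          2 * (2 * C * (1 / √(d : ℝ)) + 2 * C * (1 / √(d : ℝ))) / d := by
        field_simp
        ring
      rw [this]
      gcongr
      linarith
    have e4 : 0 ≤ 4 * P / ((d : ℝ) * (d + 2)) := by positivity
    have e5 : 0 ≤ 2 * (α + β) / ((d : ℝ) + 2) := by positivity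
    have e6 : 0 ≤ 8 * C * (1 / ((d : ℝ) * √(d : ℝ))) := by positivity
    have e7 : 0 ≤ 4 * C' * (1 / ((d : ℝ) * √(d : ℝ))) := by positivity
    rw [e1, add_mul, abs_le]
    constructor <;> linarith
  · rw [if_neg hp, if_neg (by omega), sub_zero, abs_zero]
    positivity

/-! ### Generating functions and their differential equations -/

theorem hasDerivAt_tsum_mul_pow {c : ℕ → ℂ} {B : ℝ} (hc : ∀ n, ‖c n‖ ≤ B) {z : ℂ} (hz : ‖z‖ < 1) :
    HasDerivAt (fun z => ∑' n, c n * z ^ n) (∑' n, c (n + 1) * (n + 1) * z ^ n) z := by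
  have hB : 0 ≤ B := (norm_nonneg _).trans (hc 0)
  obtain ⟨r, hzr, hr1⟩ := exists_between hz
  have hr0 : 0 ≤ r := (norm_nonneg z).trans hzr.le
  have hr : ‖r‖ < 1 := by rwa [Real.norm_eq_abs, abs_of_nonneg hr0]
  have hu : Summable fun n : ℕ => B * ((n : ℝ) * r ^ (n - 1)) := by
    refine Summable.mul_left _ ?_
    rw [← summable_nat_add_iff 1]
    have h1 := summable_pow_mul_geometric_of_norm_lt_one 1 hr
    have h2 := summable_geometric_of_norm_lt_one hr
    refine (h1.add h2).congr fun n => ?_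
    simp only [Nat.add_sub_cancel]
    push_cast
    ring
  have hd : ∀ (n : ℕ) (y : ℂ), y ∈ Metric.ball (0 : ℂ) r →
      ‖c n * (n * y ^ (n - 1))‖ ≤ B * ((n : ℝ) * r ^ (n - 1)) := by
    intro n y hy
    rw [mem_ball_zero_iff] at hy
    rw [norm_mul, norm_mul, norm_pow, Complex.norm_natCast]
    have := hc n
    gcongr
  have hz' : z ∈ Metric.ball (0 : ℂ) r := by rwa [mem_ball_zero_iff]
  have := hasDerivAt_tsum_of_isPreconnected (g := fun n z => c n * z ^ n) hu Metric.isOpen_ball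
    (convex_ball (0 : ℂ) r).isPreconnected
    (fun n y _ => (hasDerivAt_pow n y).const_mul (c n)) hd
    (Metric.mem_ball_self ((norm_nonneg z).trans_lt hzr))
    (summable_of_ne_finset_zero (s := {0}) fun n hn => by
      have : n ≠ 0 := by simpa using hn
      simp [this]) hz'
  have h : ∑' n, c (n + 1) * (n + 1) * z ^ n = ∑' n, c n * (n * z ^ (n - 1)) := by
    rw [Summable.tsum_eq_zero_add (Summable.of_norm_bounded hu fun n => hd n z hz')]
    simp [mul_assoc]
  rw [h]
  exact this

theorem summable_tCoeff_mul_pow {s : List ℕ} (hs : ∀ k ∈ s, 1 ≤ k) {z : ℂ} (hz : ‖z‖ < 1) :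
    Summable fun d => (tCoeff s d : ℂ) * z ^ d := by
  obtain ⟨B, hB⟩ := exists_tCoeff_le hs
  refine Summable.of_norm_bounded
    ((summable_geometric_of_lt_one (norm_nonneg z) hz).mul_left B) fun d => ?_
  rw [norm_mul, norm_pow, Complex.norm_real, Real.norm_of_nonneg (tCoeff_nonneg s d)]
  exact mul_le_mul_of_nonneg_right (hB d) (by positivity)

/-- The generating function of the coefficients `tCoeff s`. -/
noncomputable def tSeries (s : List ℕ) (z : ℂ) : ℂ := ∑' d, (tCoeff s d : ℂ) * z ^ d

theorem tSeries_nil (z : ℂ) : tSeries [] z = 1 := by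
  rw [tSeries, tsum_eq_single 0]
  · simp [tCoeff]
  · intro d hd
    simp [tCoeff, hd]

theorem tSeries_cons_zero (k : ℕ) (s : List ℕ) : tSeries (k :: s) 0 = 0 := by
  rw [tSeries, tsum_eq_single 0]
  · simp [tCoeff]
  · intro d hd
    simp [hd]

/-- The derivative of `tSeries s` on the unit disc. -/
noncomputable def tSeriesDeriv (s : List ℕ) (z : ℂ) : ℂ :=
  ∑' d : ℕ, (tCoeff s (d + 1) : ℂ) * (d + 1) * z ^ d

theorem hasDerivAt_tSeries {s : List ℕ} (hs : ∀ k ∈ s, 1 ≤ k) {z : ℂ} (hz : ‖z‖ < 1) :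
    HasDerivAt (tSeries s) (tSeriesDeriv s z) z := by
  obtain ⟨B, hB⟩ := exists_tCoeff_le hs
  refine hasDerivAt_tsum_mul_pow (B := B) (fun d => ?_) hz
  rw [Complex.norm_real, Real.norm_of_nonneg (tCoeff_nonneg s d)]
  exact hB d

theorem tSeriesDeriv_succ_mul (k : ℕ) {s : List ℕ} (hs : ∀ j ∈ s, 1 ≤ j) (hk : 1 ≤ k)
    {z : ℂ} (hz : ‖z‖ < 1) : tSeriesDeriv ((k + 1) :: s) z * z = tSeries (k :: s) z := by
  rw [tSeries, (summable_tCoeff_mul_pow (List.forall_mem_cons.2 ⟨hk, hs⟩) hz).tsum_eq_zero_add,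
    tSeriesDeriv, ← tsum_mul_right, tCoeff_cons_zero]
  simp only [Complex.ofReal_zero, zero_mul, zero_add]
  refine tsum_congr fun d => ?_
  have : tCoeff ((k + 1) :: s) (d + 1) * ((d : ℝ) + 1) = tCoeff (k :: s) (d + 1) := by
    rw [tCoeff, tCoeff]
    split_ifs
    · push_cast
      field_simp
      ring
    · simp
  rw [← this]
  push_cast
  ring

/-- The derivative's coefficients `e d` are twice the partial sums of `tCoeff s` on one parity
class. The skipped coefficients vanish, so `e (d + 2) - e d = 2 * tCoeff s (d + 2)`, and multiplying
by `1 - z²` takes exactly this difference. -/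
theorem tSeriesDeriv_one_mul {s : List ℕ} (hs : ∀ j ∈ s, 1 ≤ j) {z : ℂ} (hz : ‖z‖ < 1) :
    tSeriesDeriv (1 :: s) z * (1 - z ^ 2) = 2 * tSeries s z := by
  let e : ℕ → ℂ := fun d => (tCoeff (1 :: s) (d + 1) : ℂ) * (d + 1)
  have he : ∀ d, e d = if d % 2 = s.length % 2 then
      2 * ∑ j ∈ Finset.range (d + 1), (tCoeff s j : ℂ) else 0 := by
    intro d
    have h0 : (d : ℂ) + 1 ≠ 0 := by exact_mod_cast d.succ_ne_zero
    simp only [e, tCoeff]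
    by_cases h : d % 2 = s.length % 2
    · rw [if_pos (by omega), if_pos h]
      push_cast
      field_simp
    · rw [if_neg (by omega), if_neg h]
      simp
  have hsum : Summable fun d => e d * z ^ d := by
    obtain ⟨B, hB⟩ := exists_tCoeff_le (s := 1 :: s) (List.forall_mem_cons.2 ⟨le_rfl, hs⟩)
    have hz' : ‖(‖z‖ : ℝ)‖ < 1 := by simpa using hz
    have h1 := summable_pow_mul_geometric_of_norm_lt_one 1 hz'
    have h2 := summable_geometric_of_norm_lt_one hz'
    refine Summable.of_norm_bounded ((h1.add h2).mul_left B) fun d => ?_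
    have h3 : ‖(d : ℂ) + 1‖ = d + 1 := by exact_mod_cast Complex.norm_natCast (d + 1)
    rw [norm_mul, norm_mul, norm_pow, Complex.norm_real, Real.norm_of_nonneg (tCoeff_nonneg _ _),
      h3, show B * ((d : ℝ) ^ 1 * ‖z‖ ^ d + ‖z‖ ^ d) = B * (d + 1) * ‖z‖ ^ d by ring]
    have := hB (d + 1)
    gcongr
  have hstep : ∀ d, e (d + 2) = e d + 2 * tCoeff s (d + 2) := by
    intro d
    rw [he, he]
    by_cases h : d % 2 = s.length % 2
    · rw [if_pos h, if_pos (by omega), Finset.sum_range_succ, Finset.sum_range_succ,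
        tCoeff_eq_zero_of_parity (d := d + 1) (by omega)]
      simp only [Complex.ofReal_zero]
      ring
    · rw [if_neg h, if_neg (by omega), tCoeff_eq_zero_of_parity (by omega)]
      simp
  have h0 : e 0 = 2 * tCoeff s 0 := by
    rw [he]
    by_cases h : 0 % 2 = s.length % 2
    · rw [if_pos h]; simp
    · rw [if_neg h, tCoeff_eq_zero_of_parity h]; simp
  have h1 : e 1 = 2 * tCoeff s 1 := by
    rw [he]
    by_cases h : 1 % 2 = s.length % 2
    · rw [if_pos h, Finset.sum_range_succ, Finset.sum_range_one,
        tCoeff_eq_zero_of_parity (d := 0) (by omega)]; simp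
    · rw [if_neg h, tCoeff_eq_zero_of_parity h]; simp
  have hs2 := summable_tCoeff_mul_pow hs hz
  have hA := hsum.sum_add_tsum_nat_add 2
  have hB := hs2.sum_add_tsum_nat_add 2
  have hC : ∑' d, e (d + 2) * z ^ (d + 2) =
      z ^ 2 * ∑' d, e d * z ^ d + 2 * ∑' d, (tCoeff s (d + 2) : ℂ) * z ^ (d + 2) := by
    rw [← tsum_mul_left, ← tsum_mul_left, ← (hsum.mul_left _).tsum_add
      (((summable_nat_add_iff 2).2 hs2).mul_left 2)]
    refine tsum_congr fun d => ?_
    rw [hstep]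
    ring
  simp only [Finset.sum_range_succ, Finset.sum_range_zero, h0, h1, hC] at hA hB
  change (∑' d, e d * z ^ d) * (1 - z ^ 2) = 2 * ∑' d, (tCoeff s d : ℂ) * z ^ d
  linear_combination (-1 : ℂ) * hA + 2 * hB

/-! ### The substitution `z = i tan(φ/2)` -/

theorem tan_half_nonneg {φ : ℝ} (h0 : 0 ≤ φ) (h1 : φ < Real.pi / 2) : 0 ≤ Real.tan (φ / 2) :=
  Real.tan_nonneg_of_nonneg_of_le_pi_div_two (by linarith) (by linarith)

theorem tan_half_lt_one {φ : ℝ} (h0 : 0 ≤ φ) (h1 : φ < Real.pi / 2) : Real.tan (φ / 2) < 1 := by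
  rw [← Real.tan_pi_div_four]
  exact Real.tan_lt_tan_of_lt_of_lt_pi_div_two (by linarith) (by linarith) (by linarith)

theorem norm_I_mul_tan_half_lt_one {φ : ℝ} (h0 : 0 ≤ φ) (h1 : φ < Real.pi / 2) :
    ‖Complex.I * (Real.tan (φ / 2) : ℂ)‖ < 1 := by
  rw [norm_mul, Complex.norm_I, one_mul, Complex.norm_real,
    Real.norm_of_nonneg (tan_half_nonneg h0 h1)]
  exact tan_half_lt_one h0 h1

theorem cos_half_pos {φ : ℝ} (h0 : 0 ≤ φ) (h1 : φ < Real.pi / 2) : 0 < Real.cos (φ / 2) :=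
  Real.cos_pos_of_mem_Ioo ⟨by linarith, by linarith⟩

/-- The function `tSeries s` along the imaginary axis, parametrized by `φ ↦ I * tan (φ / 2)`. -/
noncomputable def tTrig (s : List ℕ) (φ : ℝ) : ℂ := tSeries s (Complex.I * (Real.tan (φ / 2) : ℂ))

theorem tTrig_nil (φ : ℝ) : tTrig [] φ = 1 := tSeries_nil _

theorem tTrig_cons_zero (k : ℕ) (s : List ℕ) : tTrig (k :: s) 0 = 0 := by
  simp [tTrig, tSeries_cons_zero]

theorem hasDerivAt_I_mul_tan_half {φ : ℝ} (h0 : 0 ≤ φ) (h1 : φ < Real.pi / 2) :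
    HasDerivAt (fun φ : ℝ => Complex.I * (Real.tan (φ / 2) : ℂ))
      (Complex.I * (1 + (Real.tan (φ / 2) : ℂ) ^ 2) / 2) φ := by
  have hc := cos_half_pos h0 h1
  have h := ((Real.hasDerivAt_tan hc.ne').comp φ ((hasDerivAt_id φ).div_const 2)).ofReal_comp
  refine (h.const_mul Complex.I).congr_deriv ?_
  have : 1 + Real.tan (φ / 2) ^ 2 = 1 / Real.cos (φ / 2) ^ 2 := by
    rw [Real.tan_eq_sin_div_cos]
    field_simp
    exact Real.cos_sq_add_sin_sq _
  rw [show (1 + (Real.tan (φ / 2) : ℂ) ^ 2) = ((1 + Real.tan (φ / 2) ^ 2 : ℝ) : ℂ) by push_cast; rfl,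
    this]
  push_cast
  ring

theorem hasDerivAt_tTrig {s : List ℕ} (hs : ∀ k ∈ s, 1 ≤ k) {φ : ℝ} (h0 : 0 ≤ φ)
    (h1 : φ < Real.pi / 2) :
    HasDerivAt (tTrig s) (tSeriesDeriv s (Complex.I * (Real.tan (φ / 2) : ℂ)) *
      (Complex.I * (1 + (Real.tan (φ / 2) : ℂ) ^ 2) / 2)) φ :=
  (hasDerivAt_tSeries hs (norm_I_mul_tan_half_lt_one h0 h1)).comp φ
    (hasDerivAt_I_mul_tan_half h0 h1)

/-- Since `1 - z² = 1 + tan²(φ/2)`, this factor cancels the one in `dz/dφ`. -/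
theorem hasDerivAt_tTrig_one {s : List ℕ} (hs : ∀ k ∈ s, 1 ≤ k) {φ : ℝ} (h0 : 0 ≤ φ)
    (h1 : φ < Real.pi / 2) : HasDerivAt (tTrig (1 :: s)) (Complex.I * tTrig s φ) φ := by
  refine (hasDerivAt_tTrig (List.forall_mem_cons.2 ⟨le_rfl, hs⟩) h0 h1).congr_deriv ?_
  have := tSeriesDeriv_one_mul hs (norm_I_mul_tan_half_lt_one h0 h1)
  rw [mul_pow, Complex.I_sq] at this
  rw [tTrig]
  linear_combination (Complex.I / 2) * this

theorem hasDerivAt_tTrig_succ {k : ℕ} (hk : 1 ≤ k) {s : List ℕ} (hs : ∀ k ∈ s, 1 ≤ k) {φ : ℝ}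
    (h0 : 0 < φ) (h1 : φ < Real.pi / 2) :
    HasDerivAt (tTrig ((k + 1) :: s)) (tTrig (k :: s) φ / Real.sin φ) φ := by
  refine (hasDerivAt_tTrig (List.forall_mem_cons.2 ⟨by omega, hs⟩) h0.le h1).congr_deriv ?_
  have := tSeriesDeriv_succ_mul k hs hk (norm_I_mul_tan_half_lt_one h0.le h1)
  rw [tTrig, ← this]
  have hs : 0 < Real.sin φ := Real.sin_pos_of_pos_of_lt_pi h0 (by linarith)
  have hs' : (Real.sin φ : ℂ) ≠ 0 := by exact_mod_cast hs.ne'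
  have key : (1 + Real.tan (φ / 2) ^ 2) / 2 * Real.sin φ = Real.tan (φ / 2) := by
    have hc := cos_half_pos h0.le h1
    have e : Real.sin φ = 2 * Real.sin (φ / 2) * Real.cos (φ / 2) := by
      rw [← Real.sin_two_mul]; ring_nf
    rw [e, Real.tan_eq_sin_div_cos]
    field_simp
    rw [Real.cos_sq_add_sin_sq, mul_one]
  have key' : (1 + (Real.tan (φ / 2) : ℂ) ^ 2) / 2 * (Real.sin φ : ℂ) = (Real.tan (φ / 2) : ℂ) := by
    exact_mod_cast key
  rw [eq_div_iff hs']
  linear_combination (tSeriesDeriv ((k + 1) :: s) (Complex.I * (Real.tan (φ / 2) : ℂ)) *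
    Complex.I) * key'

theorem continuousOn_tTrig {s : List ℕ} (hs : ∀ k ∈ s, 1 ≤ k) {x : ℝ} (hx : x < Real.pi / 2) :
    ContinuousOn (tTrig s) (Set.Icc 0 x) := fun _ ht =>
  (hasDerivAt_tTrig hs ht.1 (ht.2.trans_lt hx)).continuousAt.continuousWithinAt

theorem tTrig_replicate_one (m : ℕ) {x : ℝ} (h0 : 0 ≤ x) (h1 : x < Real.pi / 2) :
    tTrig (List.replicate m 1) x = (Complex.I * x) ^ m / m.factorial := by
  induction m generalizing x with
  | zero => simp [tTrig_nil]
  | succ m ih =>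
    have hs : ∀ k ∈ List.replicate m 1, 1 ≤ k := fun k hk => (List.eq_of_mem_replicate hk).ge
    have hint : IntervalIntegrable (fun t => Complex.I * tTrig (List.replicate m 1) t)
        MeasureTheory.volume 0 x := by
      refine ContinuousOn.intervalIntegrable ?_
      rw [Set.uIcc_of_le h0]
      exact (continuousOn_tTrig hs h1).const_smul Complex.I
    have e1 := intervalIntegral.integral_eq_sub_of_hasDerivAt (a := 0) (b := x)
      (fun t ht => by
        rw [Set.uIcc_of_le h0] at ht
        exact hasDerivAt_tTrig_one hs ht.1 (ht.2.trans_lt h1)) hint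
    have e2 := intervalIntegral.integral_eq_sub_of_hasDerivAt (a := 0) (b := x)
      (f := fun t : ℝ => (Complex.I * t) ^ (m + 1) / ((m + 1).factorial : ℂ))
      (f' := fun t => Complex.I * tTrig (List.replicate m 1) t)
      (fun t ht => by
        rw [Set.uIcc_of_le h0] at ht
        rw [ih ht.1 (ht.2.trans_lt h1)]
        have := ((((hasDerivAt_id t).ofReal_comp).const_mul Complex.I).pow (m + 1)).div_const
          ((m + 1).factorial : ℂ)
        refine this.congr_deriv ?_
        have hm : ((m : ℂ) + 1) ≠ 0 := by exact_mod_cast m.succ_ne_zero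
        have hf : (m.factorial : ℂ) ≠ 0 := by exact_mod_cast m.factorial_ne_zero
        rw [Nat.factorial_succ]
        push_cast
        simp only [id]
        field_simp) hint
    rw [e1, tTrig_cons_zero] at e2
    rw [List.replicate_succ]
    simpa using e2

/-! ### Iterated integration and the integral formula -/

/-- Cauchy's formula, by repeated integration by parts. Derivatives are required only on the open
interval, because the `dφ / sin φ` step is singular at 0. -/
theorem repeated_integral {G : ℕ → ℝ → ℂ} {c : ℂ} {x : ℝ} (hx : 0 ≤ x)
    (hG : ∀ j, ContinuousOn (G j) (Set.Icc 0 x))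
    (hd : ∀ j, ∀ t ∈ Set.Ioo 0 x, HasDerivAt (G (j + 1)) (c * G j t) t)
    (h0 : ∀ j, G (j + 1) 0 = 0) (n j : ℕ) :
    G (j + n + 1) x = c ^ (n + 1) *
      ∫ t in (0 : ℝ)..x, (((x - t) ^ n / n.factorial : ℝ) : ℂ) * G j t := by
  induction n generalizing j with
  | zero =>
    have := intervalIntegral.integral_eq_sub_of_hasDerivAt_of_le hx (hG (j + 1)) (hd j)
      (ContinuousOn.intervalIntegrable (by
        rw [Set.uIcc_of_le hx]; exact (hG j).const_smul c))
    rw [h0, sub_zero, intervalIntegral.integral_const_mul] at this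
    simp [← this]
  | succ n ih =>
    have hcont : Continuous fun t : ℝ => (((x - t) ^ (n + 1) / (n + 1).factorial : ℝ) : ℂ) := by
      fun_prop
    have hcont' : Continuous fun t : ℝ => -(((x - t) ^ n / n.factorial : ℝ) : ℂ) := by
      fun_prop
    have := intervalIntegral.integral_mul_deriv_eq_deriv_mul_of_hasDerivAt (a := 0) (b := x)
      (u := fun t : ℝ => (((x - t) ^ (n + 1) / (n + 1).factorial : ℝ) : ℂ))
      (u' := fun t : ℝ => -(((x - t) ^ n / n.factorial : ℝ) : ℂ))
      (v := G (j + 1)) (v' := fun t => c * G j t) hcont.continuousOn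
      (by rw [Set.uIcc_of_le hx]; exact hG _)
      (fun t _ => by
        have h := ((((hasDerivAt_id t).const_sub x).pow (n + 1)).div_const
          ((n + 1).factorial : ℝ)).ofReal_comp
        refine h.congr_deriv ?_
        have hf : (n.factorial : ℂ) ≠ 0 := by exact_mod_cast n.factorial_ne_zero
        have hm : ((n : ℂ) + 1) ≠ 0 := by exact_mod_cast n.succ_ne_zero
        rw [Nat.factorial_succ]
        push_cast
        simp only [id]
        field_simp)
      (fun t ht => by
        rw [min_eq_left hx, max_eq_right hx] at ht
        exact hd j t ht)
      (hcont'.intervalIntegrable _ _)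
      (ContinuousOn.intervalIntegrable (by
        rw [Set.uIcc_of_le hx]; exact (hG j).const_smul c))
    simp only [sub_self, h0, neg_mul, intervalIntegral.integral_neg] at this
    rw [show j + (n + 1) + 1 = j + 1 + n + 1 by ring, ih (j + 1)]
    have e : ∫ t in (0 : ℝ)..x, (((x - t) ^ (n + 1) / (n + 1).factorial : ℝ) : ℂ) * (c * G j t) =
        c * ∫ t in (0 : ℝ)..x, (((x - t) ^ (n + 1) / (n + 1).factorial : ℝ) : ℂ) * G j t := by
      rw [← intervalIntegral.integral_const_mul]
      congr 1
      ext t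
      ring
    rw [e] at this
    simp only [ne_eq, Nat.add_eq_zero_iff, one_ne_zero, and_false, not_false_eq_true, zero_pow,
      zero_div, Complex.ofReal_zero, zero_mul, mul_zero, sub_zero, zero_sub, neg_neg] at this
    rw [← this]
    ring

theorem sinc_pos {t : ℝ} (h0 : 0 ≤ t) (h1 : t ≤ Real.pi / 2) : 0 < Real.sinc t := by
  rcases h0.eq_or_lt with rfl | h
  · simp
  · rw [Real.sinc_of_ne_zero h.ne']
    exact div_pos (Real.sin_pos_of_pos_of_lt_pi h (by linarith [Real.pi_pos])) h

theorem continuousOn_pow_div_sinc (b : ℕ) :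
    ContinuousOn (fun t : ℝ => t ^ b / Real.sinc t) (Set.Icc 0 (Real.pi / 2)) :=
  (continuous_pow b).continuousOn.div Real.continuous_sinc.continuousOn
    fun _ ht => (sinc_pos ht.1 ht.2).ne'

/-- The integral in the evaluation of the multiple `T`-values; at `x = π / 2` it equals
`∫ (π / 2 - t) ^ n * t ^ (b + 1) / sin t` over `[0, π / 2]`. -/
noncomputable def sincIntegral (n b : ℕ) (x : ℝ) : ℝ :=
  ∫ t in (0 : ℝ)..x, (x - t) ^ n * (t ^ b / Real.sinc t)

theorem one_le_of_mem_onesTwoOnes {a b k : ℕ} (h : k ∈ onesTwoOnes a b) : 1 ≤ k := by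
  simp only [onesTwoOnes, List.mem_append, List.mem_replicate, List.mem_cons] at h
  omega

theorem tTrig_onesTwoOnes (a b : ℕ) {x : ℝ} (h0 : 0 ≤ x) (h1 : x < Real.pi / 2) :
    tTrig (1 :: onesTwoOnes a b) x = Complex.I ^ (a + b + 2) *
      ((sincIntegral (a + 1) b x / ((a + 1).factorial * (b + 1).factorial) : ℝ) : ℂ) := by
  -- `G 0` is the derivative of `G 1` divided by `I`, so that every step has the same factor `c =
  -- I`; writing it with `sinc` makes it continuous at 0.
  let G : ℕ → ℝ → ℂ := fun j => match j with
    | 0 => fun t => -Complex.I * (Complex.I ^ (b + 1) / (b + 1).factorial) *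
        ((t ^ b / Real.sinc t : ℝ) : ℂ)
    | j + 1 => tTrig (onesTwoOnes j b)
  have hs : ∀ j, ∀ k ∈ onesTwoOnes j b, 1 ≤ k := fun j k => one_le_of_mem_onesTwoOnes
  have hrep : ∀ k ∈ List.replicate b 1, 1 ≤ k := fun k hk => (List.eq_of_mem_replicate hk).ge
  have hcons : ∀ j, onesTwoOnes (j + 1) b = 1 :: onesTwoOnes j b := fun j => by
    simp [onesTwoOnes, List.replicate_succ]
  have hzero : onesTwoOnes 0 b = 2 :: List.replicate b 1 := by simp [onesTwoOnes]
  have hG : ∀ j, ContinuousOn (G j) (Set.Icc 0 x) := by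
    rintro (_ | j)
    · refine ContinuousOn.const_smul (c := -Complex.I * (Complex.I ^ (b + 1) / (b + 1).factorial)) ?_
      exact Complex.continuous_ofReal.comp_continuousOn
        ((continuousOn_pow_div_sinc b).mono (Set.Icc_subset_Icc_right h1.le))
    · exact continuousOn_tTrig (hs j) h1
  have hd : ∀ j, ∀ t ∈ Set.Ioo 0 x, HasDerivAt (G (j + 1)) (Complex.I * G j t) t := by
    rintro (_ | j) t ht
    · have ht1 : t < Real.pi / 2 := ht.2.trans h1
      have := hasDerivAt_tTrig_succ (k := 1) le_rfl hrep ht.1 ht1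
      change HasDerivAt (tTrig (onesTwoOnes 0 b)) _ t
      rw [hzero]
      refine this.congr_deriv ?_
      rw [← List.replicate_succ, tTrig_replicate_one _ ht.1.le ht1]
      simp only [G]
      have hsin : (Real.sin t : ℂ) ≠ 0 := by
        exact_mod_cast (Real.sin_pos_of_pos_of_lt_pi ht.1 (by linarith)).ne'
      have ht0 : (t : ℂ) ≠ 0 := by exact_mod_cast ht.1.ne'
      have hf : ((b + 1).factorial : ℂ) ≠ 0 := by exact_mod_cast (b + 1).factorial_ne_zero
      rw [Real.sinc_of_ne_zero ht.1.ne']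
      push_cast [-Complex.ofReal_sin]
      field_simp
      rw [Complex.I_sq]
      ring
    · have := hasDerivAt_tTrig_one (hs j) ht.1.le (ht.2.trans h1)
      rwa [← hcons] at this
  have h00 : ∀ j, G (j + 1) 0 = 0 := by
    rintro (_ | j)
    · change tTrig (onesTwoOnes 0 b) 0 = 0
      rw [hzero, tTrig_cons_zero]
    · change tTrig (onesTwoOnes (j + 1) b) 0 = 0
      rw [hcons, tTrig_cons_zero]
  have := repeated_integral h0 hG hd h00 (a + 1) 0
  rw [zero_add] at this
  change tTrig (onesTwoOnes (a + 1) b) x = _ at this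
  rw [← hcons, this]
  have e : ∀ t : ℝ, (((x - t) ^ (a + 1) / (a + 1).factorial : ℝ) : ℂ) * G 0 t =
      (-Complex.I * (Complex.I ^ (b + 1) / ((a + 1).factorial * (b + 1).factorial))) *
        (((x - t) ^ (a + 1) * (t ^ b / Real.sinc t) : ℝ) : ℂ) := by
    intro t
    simp only [G]
    push_cast
    field_simp
  simp_rw [e]
  rw [intervalIntegral.integral_const_mul, intervalIntegral.integral_ofReal, sincIntegral]
  push_cast
  linear_combination (-(Complex.I ^ (a + b + 2) / ((a + 1).factorial * (b + 1).factorial) *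
    ((∫ t in (0 : ℝ)..x, (x - t) ^ (a + 1) * (t ^ b / Real.sinc t) : ℝ) : ℂ))) * Complex.I_sq

theorem intervalIntegrable_pow_div_sinc (b : ℕ) {x : ℝ} (h0 : 0 ≤ x) (h1 : x ≤ Real.pi / 2) :
    IntervalIntegrable (fun t : ℝ => t ^ b / Real.sinc t) MeasureTheory.volume 0 x := by
  refine ContinuousOn.intervalIntegrable ?_
  rw [Set.uIcc_of_le h0]
  exact (continuousOn_pow_div_sinc b).mono (Set.Icc_subset_Icc_right h1)

/-- Separating `x` from `t` serves twice: for continuity in `x` up to `π/2`, and for reducing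
membership in the ring to integrals of `t ^ m / sinc t`. -/
theorem sincIntegral_eq_sum (n b : ℕ) {x : ℝ} (h0 : 0 ≤ x) (h1 : x ≤ Real.pi / 2) :
    sincIntegral n b x = ∑ k ∈ Finset.range (n + 1), x ^ k * (-1) ^ (n - k) * (n.choose k) *
      ∫ t in (0 : ℝ)..x, t ^ (n - k + b) / Real.sinc t := by
  have e : ∀ t : ℝ, (x - t) ^ n * (t ^ b / Real.sinc t) = ∑ k ∈ Finset.range (n + 1),
      x ^ k * (-1) ^ (n - k) * (n.choose k) * (t ^ (n - k + b) / Real.sinc t) := by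
    intro t
    rw [sub_eq_add_neg, add_pow, Finset.sum_mul]
    refine Finset.sum_congr rfl fun k _ => ?_
    rw [neg_pow t, pow_add]
    ring
  rw [sincIntegral]
  simp_rw [e]
  rw [intervalIntegral.integral_finsetSum fun k _ =>
    (intervalIntegrable_pow_div_sinc _ h0 h1).const_mul _]
  simp_rw [intervalIntegral.integral_const_mul]

/-! ### The limit `φ → π/2` and Abel's theorem -/

theorem tendsto_sincIntegral (n b : ℕ) :
    Tendsto (sincIntegral n b) (𝓝[<] (Real.pi / 2)) (𝓝 (sincIntegral n b (Real.pi / 2))) := by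
  have hpi := Real.pi_pos
  have hcont : ContinuousOn (sincIntegral n b) (Set.Icc 0 (Real.pi / 2)) := by
    refine ContinuousOn.congr ?_ fun x hx => sincIntegral_eq_sum n b hx.1 hx.2
    refine continuousOn_finsetSum _ fun k _ => ContinuousOn.mul (by fun_prop) ?_
    have := intervalIntegral.continuousOn_primitive_interval (a := 0) (b := Real.pi / 2)
      (f := fun t : ℝ => t ^ (n - k + b) / Real.sinc t) (μ := MeasureTheory.volume) (by
        rw [Set.uIcc_of_le (by linarith)]
        exact (continuousOn_pow_div_sinc _).integrableOn_Icc)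
    rwa [Set.uIcc_of_le (by linarith)] at this
  have h := hcont (Real.pi / 2) ⟨by linarith, le_rfl⟩
  refine h.tendsto.mono_left ?_
  rw [nhdsWithin_le_iff]
  filter_upwards [Ioo_mem_nhdsLT (show (0 : ℝ) < Real.pi / 2 by linarith)] with x hx
  exact ⟨hx.1.le, hx.2.le⟩

theorem tendsto_tan_half : Tendsto (fun φ : ℝ => Real.tan (φ / 2)) (𝓝[<] (Real.pi / 2)) (𝓝[<] 1) := by
  have hpi := Real.pi_pos
  refine tendsto_nhdsWithin_iff.2 ⟨?_, ?_⟩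
  · have h : ContinuousAt (fun φ : ℝ => Real.tan (φ / 2)) (Real.pi / 2) := by
      refine ContinuousAt.comp (g := Real.tan) (f := fun φ : ℝ => φ / 2) ?_ (by fun_prop)
      rw [Real.continuousAt_tan]
      exact (Real.cos_pos_of_mem_Ioo ⟨by linarith, by linarith⟩).ne'
    have h2 := h.tendsto
    rw [show Real.pi / 2 / 2 = Real.pi / 4 by ring, Real.tan_pi_div_four] at h2
    exact h2.mono_left nhdsWithin_le_nhds
  · filter_upwards [Ioo_mem_nhdsLT (show (0 : ℝ) < Real.pi / 2 by linarith)] with x hx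
    exact tan_half_lt_one hx.1.le hx.2

theorem tendsto_sum_tCoeff_mul_I_pow (a b : ℕ) :
    Tendsto (fun N => ∑ d ∈ Finset.range N, (tCoeff (1 :: onesTwoOnes a b) d : ℂ) * Complex.I ^ d)
      atTop (𝓝 (Complex.I ^ (a + b + 2) * ((sincIntegral (a + 1) b (Real.pi / 2) /
        ((a + 1).factorial * (b + 1).factorial) : ℝ) : ℂ))) := by
  have hs : ∀ k ∈ onesTwoOnes a b, 1 ≤ k := fun k => one_le_of_mem_onesTwoOnes
  obtain ⟨l, hl⟩ : ∃ l : ℂ, Tendsto (fun N => ∑ d ∈ Finset.range N,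
      (tCoeff (1 :: onesTwoOnes a b) d : ℂ) * Complex.I ^ d) atTop (𝓝 l) := by
    refine exists_tendsto_sum_mul_I_pow (tendsto_tCoeff_cons le_rfl hs) ?_
    cases h : onesTwoOnes a b with
    | nil => simp [onesTwoOnes] at h
    | cons k s =>
      rw [h] at hs
      exact summable_tCoeff_sub (hs k (by simp)) fun j hj => hs j (List.mem_cons_of_mem _ hj)
  -- Abel's theorem for the coefficients `tCoeff d * I ^ d` along `tan(φ/2) → 1⁻`.
  have h1 := (Complex.tendsto_tsum_powerSeries_nhdsWithin_lt hl).comp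
    (tendsto_map.comp tendsto_tan_half)
  have h2 : Tendsto (tTrig (1 :: onesTwoOnes a b)) (𝓝[<] (Real.pi / 2)) (𝓝 l) := by
    refine h1.congr fun φ => ?_
    simp only [Function.comp, tTrig, tSeries, mul_pow, mul_assoc]
  have h3 : Tendsto (tTrig (1 :: onesTwoOnes a b)) (𝓝[<] (Real.pi / 2))
      (𝓝 (Complex.I ^ (a + b + 2) * ((sincIntegral (a + 1) b (Real.pi / 2) /
        ((a + 1).factorial * (b + 1).factorial) : ℝ) : ℂ))) := by
    have := ((Complex.continuous_ofReal.tendsto _).comp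
      ((tendsto_sincIntegral (a + 1) b).div_const ((a + 1).factorial * (b + 1).factorial))).const_mul
        (Complex.I ^ (a + b + 2))
    refine this.congr' ?_
    filter_upwards [Ioo_mem_nhdsLT (show (0 : ℝ) < Real.pi / 2 by linarith [Real.pi_pos])] with x hx
    exact (tTrig_onesTwoOnes a b hx.1.le hx.2).symm
  rwa [tendsto_nhds_unique h2 h3] at hl

theorem exists_sign_eq_slotUnit_mul_I_pow (r : ℕ) :
    ∃ ε : ℤ, slotUnit r * Complex.I ^ r = (ε : ℂ) := by
  rcases Nat.even_or_odd r with hr | hr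
  · obtain ⟨k, rfl⟩ := hr
    refine ⟨(-1) ^ k, ?_⟩
    rw [slotUnit, if_pos ⟨k, rfl⟩, ← two_mul, pow_mul, Complex.I_sq]
    push_cast
    ring
  · obtain ⟨k, rfl⟩ := hr
    refine ⟨(-1) ^ (k + 1), ?_⟩
    rw [slotUnit, if_neg (by simp), ← pow_succ', show 2 * k + 1 + 1 = 2 * (k + 1) by ring, pow_mul,
      Complex.I_sq]
    push_cast
    ring

theorem exists_tendsto_altTHarmonic_barOneTwo (a b : ℕ) :
    ∃ ε : ℤ, Tendsto (fun n => altTHarmonic n (barOneTwo a b)) atTop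
      (𝓝 (ε * (sincIntegral (a + 1) b (Real.pi / 2) / ((a + 1).factorial * (b + 1).factorial)))) := by
  obtain ⟨ε, hε⟩ := exists_sign_eq_slotUnit_mul_I_pow (a + b + 2)
  refine ⟨ε, ?_⟩
  have h := ((tendsto_sum_tCoeff_mul_I_pow a b).comp
    (tendsto_id.const_mul_atTop' (show 0 < 2 by norm_num))).const_mul (slotUnit (a + b + 2))
  rw [← mul_assoc, hε] at h
  have h2 : Tendsto (fun n => (altTHarmonic n (barOneTwo a b) : ℂ)) atTop _ :=
    h.congr fun n => (ofReal_altTHarmonic_barOneTwo a b n).symm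
  have h3 := (Complex.continuous_re.tendsto _).comp h2
  have e : ((ε : ℂ) * ((sincIntegral (a + 1) b (Real.pi / 2) /
        ((a + 1).factorial * (b + 1).factorial) : ℝ) : ℂ)).re =
      ε * (sincIntegral (a + 1) b (Real.pi / 2) / ((a + 1).factorial * (b + 1).factorial)) := by
    rw [← Complex.ofReal_intCast, ← Complex.ofReal_mul, Complex.ofReal_re]
  rw [e] at h3
  exact h3

/-! ### Odd zeta and beta sums in the ring -/

theorem pi_mem_piZetaBetaRing : Real.pi ∈ piZetaBetaRing :=
  Algebra.subset_adjoin (Or.inl (Or.inl rfl))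

theorem ratCast_mem_piZetaBetaRing (q : ℚ) : (q : ℝ) ∈ piZetaBetaRing :=
  piZetaBetaRing.algebraMap_mem q

theorem betaValue_mem_piZetaBetaRing {k : ℕ} (hk : 2 ≤ k) : betaValue k ∈ piZetaBetaRing :=
  Algebra.subset_adjoin (Or.inr ⟨k, hk, rfl⟩)

theorem tsum_one_div_pow_mem_piZetaBetaRing {k : ℕ} (hk : 2 ≤ k) :
    ∑' n : ℕ, 1 / (n : ℝ) ^ k ∈ piZetaBetaRing := by
  refine Algebra.subset_adjoin (Or.inl (Or.inr ⟨k, hk, ?_⟩))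
  rw [zeta_nat_eq_tsum_of_gt_one (by omega)]
  push_cast
  rfl

/-- Removing the even terms from `ζ(p)` leaves `(1 - 2^(-p)) ζ(p)`. -/
theorem exists_hasSum_one_div_odd_pow {p : ℕ} (hp : 2 ≤ p) :
    ∃ s ∈ piZetaBetaRing, HasSum (fun k : ℕ => 1 / (2 * (k : ℝ) + 1) ^ p) s := by
  have hsum : Summable fun n : ℕ => 1 / (n : ℝ) ^ p := Real.summable_one_div_nat_pow.2 (by omega)
  have hodd : Summable fun k : ℕ => 1 / ((2 * k + 1 : ℕ) : ℝ) ^ p :=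
    hsum.comp_injective (i := fun k : ℕ => 2 * k + 1) fun a b h => by simpa using h
  have heven : HasSum (fun k : ℕ => 1 / ((2 * k : ℕ) : ℝ) ^ p)
      (1 / 2 ^ p * ∑' n : ℕ, 1 / (n : ℝ) ^ p) := by
    refine (hsum.hasSum.mul_left (1 / 2 ^ p)).congr_fun fun k => ?_
    push_cast
    rw [mul_pow]
    ring
  have h := (HasSum.even_add_odd (f := fun n : ℕ => 1 / (n : ℝ) ^ p) heven hodd.hasSum).unique
    hsum.hasSum
  refine ⟨_, ?_, by simpa using hodd.hasSum⟩
  have e : ∑' k : ℕ, 1 / (2 * (k : ℝ) + 1) ^ p =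
      ((1 - 1 / 2 ^ p : ℚ) : ℝ) * ∑' n : ℕ, 1 / (n : ℝ) ^ p := by
    push_cast at h ⊢
    linarith
  simp only [one_div] at e ⊢
  rw [e]
  exact mul_mem (ratCast_mem_piZetaBetaRing _)
    (by simpa only [one_div] using tsum_one_div_pow_mem_piZetaBetaRing hp)

theorem exists_hasSum_neg_one_pow_div_odd_pow {p : ℕ} (hp : 2 ≤ p) :
    ∃ s ∈ piZetaBetaRing, HasSum (fun k : ℕ => (-1 : ℝ) ^ k / (2 * (k : ℝ) + 1) ^ p) s := by
  obtain ⟨_, _, h⟩ := exists_hasSum_one_div_odd_pow hp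
  refine ⟨betaValue p, betaValue_mem_piZetaBetaRing hp, Summable.hasSum (Summable.of_norm ?_)⟩
  refine h.summable.congr fun k => ?_
  rw [norm_div, norm_pow, norm_neg, norm_one, one_pow, Real.norm_of_nonneg (by positivity)]

/-! ### Trigonometric moments -/

/-- The moment `∫ t ^ m * sin ((2 k + 1) t)` over `[0, π / 2]`. -/
noncomputable def sinMoment (m k : ℕ) : ℝ :=
  ∫ t in (0 : ℝ)..(Real.pi / 2), t ^ m * Real.sin ((2 * k + 1) * t)

/-- The moment `∫ t ^ m * cos ((2 k + 1) t)` over `[0, π / 2]`. -/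
noncomputable def cosMoment (m k : ℕ) : ℝ :=
  ∫ t in (0 : ℝ)..(Real.pi / 2), t ^ m * Real.cos ((2 * k + 1) * t)

theorem sin_odd_mul_pi_div_two (k : ℕ) : Real.sin ((2 * k + 1) * (Real.pi / 2)) = (-1) ^ k := by
  rw [show (2 * (k : ℝ) + 1) * (Real.pi / 2) = Real.pi / 2 + k * Real.pi by ring,
    Real.sin_add_nat_mul_pi, Real.sin_pi_div_two, mul_one]

theorem cos_odd_mul_pi_div_two (k : ℕ) : Real.cos ((2 * k + 1) * (Real.pi / 2)) = 0 := by
  rw [show (2 * (k : ℝ) + 1) * (Real.pi / 2) = Real.pi / 2 + k * Real.pi by ring,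
    Real.cos_add_nat_mul_pi, Real.cos_pi_div_two, mul_zero]

theorem hasDerivAt_sin_mul_div {c : ℝ} (hc : c ≠ 0) (t : ℝ) :
    HasDerivAt (fun t => Real.sin (c * t) / c) (Real.cos (c * t)) t := by
  have := (((hasDerivAt_id t).const_mul c).sin).div_const c
  refine this.congr_deriv ?_
  simp only [id]
  field_simp

theorem hasDerivAt_neg_cos_mul_div {c : ℝ} (hc : c ≠ 0) (t : ℝ) :
    HasDerivAt (fun t => -Real.cos (c * t) / c) (Real.sin (c * t)) t := by
  have := (((hasDerivAt_id t).const_mul c).cos).neg.div_const c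
  refine this.congr_deriv ?_
  simp only [id]
  field_simp

theorem two_mul_add_one_ne_zero (k : ℕ) : (2 * (k : ℝ) + 1) ≠ 0 := by positivity

theorem sinMoment_zero (k : ℕ) : sinMoment 0 k = 1 / (2 * k + 1) := by
  have := intervalIntegral.integral_eq_sub_of_hasDerivAt (a := 0) (b := Real.pi / 2)
    (fun t _ => hasDerivAt_neg_cos_mul_div (two_mul_add_one_ne_zero k) t)
    (Continuous.intervalIntegrable (by fun_prop) _ _)
  simp only [sinMoment, pow_zero, one_mul, this, cos_odd_mul_pi_div_two, mul_zero, Real.cos_zero]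
  ring

theorem cosMoment_zero (k : ℕ) : cosMoment 0 k = (-1) ^ k / (2 * k + 1) := by
  have := intervalIntegral.integral_eq_sub_of_hasDerivAt (a := 0) (b := Real.pi / 2)
    (fun t _ => hasDerivAt_sin_mul_div (two_mul_add_one_ne_zero k) t)
    (Continuous.intervalIntegrable (by fun_prop) _ _)
  simp only [cosMoment, pow_zero, one_mul, this, sin_odd_mul_pi_div_two, mul_zero, Real.sin_zero]
  ring

theorem hasDerivAt_pow_succ (m : ℕ) (t : ℝ) :
    HasDerivAt (fun t : ℝ => t ^ (m + 1)) ((m + 1) * t ^ m) t := by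
  simpa using hasDerivAt_pow (m + 1) t

theorem sinMoment_succ (m k : ℕ) :
    sinMoment (m + 1) k = (m + 1) * (cosMoment m k / (2 * k + 1)) := by
  have := intervalIntegral.integral_mul_deriv_eq_deriv_mul (a := 0) (b := Real.pi / 2)
    (fun t _ => hasDerivAt_pow_succ m t)
    (fun t _ => hasDerivAt_neg_cos_mul_div (two_mul_add_one_ne_zero k) t)
    (Continuous.intervalIntegrable (by fun_prop) _ _)
    (Continuous.intervalIntegrable (by fun_prop) _ _)
  rw [sinMoment, this, cos_odd_mul_pi_div_two, cosMoment]
  have e : ∀ t : ℝ, ((m : ℝ) + 1) * t ^ m * (-Real.cos ((2 * k + 1) * t) / (2 * k + 1)) =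
      -(((m : ℝ) + 1) / (2 * k + 1)) * (t ^ m * Real.cos ((2 * k + 1) * t)) := fun t => by ring
  simp_rw [e]
  rw [intervalIntegral.integral_const_mul]
  simp
  ring

theorem cosMoment_succ (m k : ℕ) :
    cosMoment (m + 1) k = (Real.pi / 2) ^ (m + 1) * ((-1) ^ k / (2 * k + 1)) -
      (m + 1) * (sinMoment m k / (2 * k + 1)) := by
  have := intervalIntegral.integral_mul_deriv_eq_deriv_mul (a := 0) (b := Real.pi / 2)
    (fun t _ => hasDerivAt_pow_succ m t)
    (fun t _ => hasDerivAt_sin_mul_div (two_mul_add_one_ne_zero k) t)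
    (Continuous.intervalIntegrable (by fun_prop) _ _)
    (Continuous.intervalIntegrable (by fun_prop) _ _)
  rw [cosMoment, this, sin_odd_mul_pi_div_two, sinMoment]
  have e : ∀ t : ℝ, ((m : ℝ) + 1) * t ^ m * (Real.sin ((2 * k + 1) * t) / (2 * k + 1)) =
      (((m : ℝ) + 1) / (2 * k + 1)) * (t ^ m * Real.sin ((2 * k + 1) * t)) := fun t => by ring
  simp_rw [e]
  rw [intervalIntegral.integral_const_mul]
  simp
  ring

theorem pi_div_two_mem_piZetaBetaRing : Real.pi / 2 ∈ piZetaBetaRing := by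
  have := mul_mem pi_mem_piZetaBetaRing (ratCast_mem_piZetaBetaRing (1 / 2))
  push_cast at this
  rwa [show Real.pi / 2 = Real.pi * (1 / 2) by ring]

theorem natCast_add_one_mem_piZetaBetaRing (m : ℕ) : ((m : ℝ) + 1) ∈ piZetaBetaRing := by
  exact_mod_cast ratCast_mem_piZetaBetaRing (m + 1)

/-- Integration by parts lowers `m` by one and raises `p` by one, so `p` must stay general although
only `p = 1` is used later. Starting from `p ≥ 1` keeps every resulting exponent at least 2. -/
theorem exists_hasSum_moments (m : ℕ) : ∀ p : ℕ, 1 ≤ p →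
    (∃ s ∈ piZetaBetaRing, HasSum (fun k : ℕ => sinMoment m k / (2 * (k : ℝ) + 1) ^ p) s) ∧
      ∃ s ∈ piZetaBetaRing, HasSum (fun k : ℕ => cosMoment m k / (2 * (k : ℝ) + 1) ^ p) s := by
  induction m with
  | zero =>
    intro p hp
    obtain ⟨s, hs, h⟩ := exists_hasSum_one_div_odd_pow (p := p + 1) (by omega)
    obtain ⟨s', hs', h'⟩ := exists_hasSum_neg_one_pow_div_odd_pow (p := p + 1) (by omega)
    refine ⟨⟨s, hs, h.congr_fun fun k => ?_⟩, ⟨s', hs', h'.congr_fun fun k => ?_⟩⟩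
    · rw [sinMoment_zero, div_div, pow_succ']
    · rw [cosMoment_zero, div_div, pow_succ']
  | succ m ih =>
    intro p hp
    obtain ⟨⟨s, hs, h⟩, ⟨s', hs', h'⟩⟩ := ih (p + 1) (by omega)
    obtain ⟨u, hu, hb⟩ := exists_hasSum_neg_one_pow_div_odd_pow (p := p + 1) (by omega)
    refine ⟨⟨(m + 1) * s', mul_mem (natCast_add_one_mem_piZetaBetaRing m) hs',
      (h'.mul_left _).congr_fun fun k => ?_⟩,
      ⟨(Real.pi / 2) ^ (m + 1) * u - (m + 1) * s,
        sub_mem (mul_mem (pow_mem pi_div_two_mem_piZetaBetaRing _) hu)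
          (mul_mem (natCast_add_one_mem_piZetaBetaRing m) hs),
        ((hb.mul_left _).sub (h.mul_left _)).congr_fun fun k => ?_⟩⟩
    · rw [sinMoment_succ, pow_succ']
      have := two_mul_add_one_ne_zero k
      field_simp
    · rw [cosMoment_succ, pow_succ' (2 * (k : ℝ) + 1)]
      have := two_mul_add_one_ne_zero k
      field_simp

/-! ### Expansion of `1 / sin t` and the Riemann–Lebesgue lemma -/

theorem sum_two_mul_sin_odd_mul_sin (N : ℕ) (t : ℝ) :
    (∑ k ∈ Finset.range N, 2 * Real.sin ((2 * k + 1) * t)) * Real.sin t =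
      1 - Real.cos (2 * N * t) := by
  induction N with
  | zero => simp
  | succ N ih =>
    rw [Finset.sum_range_succ, add_mul, ih]
    have h1 : Real.cos (2 * N * t) = Real.cos ((2 * N + 1) * t - t) := by ring_nf
    have h2 : Real.cos (2 * (N + 1 : ℕ) * t) = Real.cos ((2 * N + 1) * t + t) := by
      push_cast
      ring_nf
    rw [h1, h2, Real.cos_sub, Real.cos_add]
    ring

theorem tendsto_integral_mul_cos {f : ℝ → ℝ} {x : ℝ} (hx : 0 ≤ x)
    (hf : IntervalIntegrable f MeasureTheory.volume 0 x) :
    Tendsto (fun N : ℕ => ∫ t in (0 : ℝ)..x, f t * Real.cos (2 * N * t)) atTop (𝓝 0) := by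
  have hpi := Real.pi_pos
  -- The Fourier kernel is `exp(-2πi t ξ)`, so `ξ = N/π` produces the frequency `2N`.
  have hN : Tendsto (fun N : ℕ => (N : ℝ) / Real.pi) atTop (cocompact ℝ) :=
    (tendsto_natCast_atTop_atTop.atTop_div_const hpi).mono_right atTop_le_cocompact
  have h := (Real.tendsto_integral_exp_smul_cocompact
    ((Set.Ioc 0 x).indicator fun t => (f t : ℂ))).comp hN
  have h2 := (Complex.continuous_re.tendsto _).comp h
  rw [Complex.zero_re] at h2
  refine h2.congr fun N => ?_
  have e : ∀ t : ℝ, Real.fourierChar (-(t * ((N : ℝ) / Real.pi))) •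
      (Set.Ioc 0 x).indicator (fun t => (f t : ℂ)) t =
      (Set.Ioc 0 x).indicator (fun t => Complex.exp ((-(2 * N * t) : ℝ) * Complex.I) * (f t : ℂ)) t := by
    intro t
    by_cases ht : t ∈ Set.Ioc 0 x
    · rw [Set.indicator_of_mem ht, Set.indicator_of_mem ht, Circle.smul_def, Real.fourierChar_apply,
        smul_eq_mul]
      congr 3
      push_cast
      have : (Real.pi : ℂ) ≠ 0 := by exact_mod_cast hpi.ne'
      field_simp
    · rw [Set.indicator_of_notMem ht, Set.indicator_of_notMem ht, smul_zero]
  simp only [Function.comp, e]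
  rw [MeasureTheory.integral_indicator measurableSet_Ioc, ← intervalIntegral.integral_of_le hx]
  have hint : IntervalIntegrable (fun t : ℝ => Complex.exp ((-(2 * N * t) : ℝ) * Complex.I) *
      (f t : ℂ)) MeasureTheory.volume 0 x := by
    have hfc : IntervalIntegrable (fun t : ℝ => (f t : ℂ)) MeasureTheory.volume 0 x :=
      ⟨hf.1.ofReal, hf.2.ofReal⟩
    exact hfc.continuousOn_mul (by fun_prop)
  have := Complex.reCLM.intervalIntegral_comp_comm hint
  rw [Complex.reCLM_apply] at this
  rw [← this]
  congr 1
  ext t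
  rw [Complex.reCLM_apply, Complex.re_mul_ofReal, Complex.exp_ofReal_mul_I_re, Real.cos_neg, mul_comm]

theorem sum_two_mul_sinMoment (m N : ℕ) :
    ∑ k ∈ Finset.range N, 2 * sinMoment (m + 1) k =
      (∫ t in (0 : ℝ)..(Real.pi / 2), t ^ m / Real.sinc t) -
        ∫ t in (0 : ℝ)..(Real.pi / 2), t ^ m / Real.sinc t * Real.cos (2 * N * t) := by
  have hpi := Real.pi_pos
  have hint := intervalIntegrable_pow_div_sinc m (by linarith) (le_refl (Real.pi / 2))
  rw [← intervalIntegral.integral_sub hint (hint.mul_continuousOn (by fun_prop))]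
  simp only [sinMoment]
  simp_rw [← intervalIntegral.integral_const_mul]
  rw [← intervalIntegral.integral_finsetSum fun k _ =>
    Continuous.intervalIntegrable (by fun_prop) _ _]
  refine intervalIntegral.integral_congr fun t ht => ?_
  rw [Set.uIcc_of_le (by linarith)] at ht
  rcases ht.1.eq_or_lt with rfl | h0
  · simp
  · have hs : 0 < Real.sin t := Real.sin_pos_of_pos_of_lt_pi h0 (by linarith [ht.2])
    have e : t ^ m / Real.sinc t = t ^ (m + 1) / Real.sin t := by
      rw [Real.sinc_of_ne_zero h0.ne', pow_succ]
      field_simp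
    have key := sum_two_mul_sin_odd_mul_sin N t
    rw [e, show t ^ (m + 1) / Real.sin t - t ^ (m + 1) / Real.sin t * Real.cos (2 * N * t) =
      t ^ (m + 1) / Real.sin t * (1 - Real.cos (2 * N * t)) by ring, ← key,
      mul_comm _ (Real.sin t), ← mul_assoc, div_mul_cancel₀ _ hs.ne', Finset.mul_sum]
    refine Finset.sum_congr rfl fun k _ => ?_
    ring

/-- Letting `N → ∞` in `sum_two_mul_sinMoment` kills the cosine integral, so the integral equals
`2(m+1) ∑ cosMoment m k / (2k+1)`. -/
theorem integral_pow_div_sinc_mem (m : ℕ) :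
    ∫ t in (0 : ℝ)..(Real.pi / 2), t ^ m / Real.sinc t ∈ piZetaBetaRing := by
  have hpi := Real.pi_pos
  obtain ⟨_, s, hs, h⟩ := exists_hasSum_moments m 1 le_rfl
  have h1 : HasSum (fun k => 2 * sinMoment (m + 1) k) (2 * (m + 1) * s) := by
    refine (h.mul_left _).congr_fun fun k => ?_
    rw [sinMoment_succ, pow_one]
    ring
  have h2 := (tendsto_const_nhds (x := ∫ t in (0 : ℝ)..(Real.pi / 2), t ^ m / Real.sinc t)).sub
    (tendsto_integral_mul_cos (by linarith)
      (intervalIntegrable_pow_div_sinc m (by linarith) (le_refl (Real.pi / 2))))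
  have h3 := tendsto_nhds_unique
    (h1.tendsto_sum_nat.congr fun N => sum_two_mul_sinMoment m N) h2
  rw [sub_zero] at h3
  rw [← h3]
  refine mul_mem (mul_mem ?_ (natCast_add_one_mem_piZetaBetaRing m)) hs
  exact_mod_cast ratCast_mem_piZetaBetaRing 2

theorem sincIntegral_pi_div_two_mem (n b : ℕ) :
    sincIntegral n b (Real.pi / 2) ∈ piZetaBetaRing := by
  rw [sincIntegral_eq_sum n b (by positivity) le_rfl]
  refine sum_mem fun k _ => mul_mem (mul_mem (mul_mem
    (pow_mem pi_div_two_mem_piZetaBetaRing _) ?_) ?_) (integral_pow_div_sinc_mem _)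
  · exact pow_mem (neg_mem (one_mem _)) _
  · exact natCast_mem _ _

theorem mainTheorem8 (a b : ℕ) :
    Tendsto (fun n : ℕ => altTHarmonic n (barOneTwo a b)) atTop (𝓝 (altT (barOneTwo a b))) ∧
      altT (barOneTwo a b) ∈ piZetaBetaRing := by
  obtain ⟨ε, h⟩ := exists_tendsto_altTHarmonic_barOneTwo a b
  have e : altT (barOneTwo a b) = _ := h.limUnder_eq
  rw [e]
  refine ⟨h, mul_mem (intCast_mem _ _) ?_⟩
  have := mul_mem (sincIntegral_pi_div_two_mem (a + 1) b)
    (ratCast_mem_piZetaBetaRing (1 / ((a + 1).factorial * (b + 1).factorial)))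
  push_cast at this
  rwa [div_eq_mul_one_div]
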